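/- Let $n\ge 6$ be even and let $\mathrm{Tr}$ denote the absolute trace from $\mathrm{GF}(2^n)$ to $\mathrm{GF}(2)$. Let $f:\mathrm{GF}(2^n)\to\mathrm{GF}(2)$ be a bent function, i.e. $\sum_{x\in \mathrm{GF}(2^n)}(-1)^{f(x)+\mathrm{Tr}(\mu x)}=\pm 2^{n/2}$ for all $\mu\in\mathrm{GF}(2^n)$. Let $D_f=\{x: f(x)=1\}=\{d_0,\dots,d_{\nu_f-1}\}$ be its support, with $\nu_f=\# D_f$, and let $$\mathcal C(D_f)=\{(\mathrm{Tr}(xd_0)+y,\dots,\mathrm{Tr}(xd_{\nu_f-1})+y): x\in\mathrm{GF}(2^n),\ y\in\mathrm{GF}(2)\}.$$ For $0\le t_1<\nu_f$ let $\mathcal C(D_f)_{\{t_1\}}$ be the shortened code on the coordinate $t_1$, i.e. the code obtained by taking all codewords of $\mathcal C(D_f)$ that are $0$ at coordinate $t_1$ and deleting that coordinate. Then $\mathcal C(D_f)_{\{t_1\}}$ is a binary linear code of length $\nu_f-1$ and dimension $n$. It is a two-weight code (its nonzero codewords have exactly two distinct Hamming weights), and its weight distribution is: one codeword of weight $0$;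 $\frac{\nu_f+2^{(n-2)/2}}{2\nu_f}(2^n-1)$ codewords of weight $\frac{\nu_f}{2}-2^{(n-4)/2}$; $\frac{\nu_f-2^{(n-2)/2}}{2\nu_f}(2^n-1)$ codewords of weight $\frac{\nu_f}{2}+2^{(n-4)/2}$; and no codewords of any other weight. -/

import Mathlib

namespace BentCode

section Codes

variable {F : Type*} [Field F] {ι : Type*}

/-- The length of a linear code whose coordinate positions are the elements of `ι`. -/
def length [Fintype ι] (_C : Submodule F (ι → F)) : ℕ := Fintype.card ι

/-- The dimension of a linear code. -/
noncomputable def dimension (C : Submodule F (ι → F)) : ℕ := Module.finrank F C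

/-- `C(T)`: the subcode of all codewords of `C` that are zero on `T`. -/
def zeroOn (C : Submodule F (ι → F)) (T : Finset ι) : Submodule F (ι → F) where
  carrier := {c | c ∈ C ∧ ∀ i ∈ T, c i = 0}
  zero_mem' := ⟨C.zero_mem, fun _ _ => rfl⟩
  add_mem' := fun ha hb =>
    ⟨C.add_mem ha.1 hb.1, fun i hi => by simp [ha.2 i hi, hb.2 i hi]⟩
  smul_mem' := fun r _ ha =>
    ⟨C.smul_mem r ha.1, fun i hi => by simp [ha.2 i hi]⟩

/-- `C^T`: the code punctured on `T`, that is, the coordinates in `T` are deleted from every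
codeword. -/
def punctured (C : Submodule F (ι → F)) (T : Finset ι) :
    Submodule F ({i : ι // i ∉ T} → F) :=
  C.map (LinearMap.funLeft F F (Subtype.val : {i : ι // i ∉ T} → ι))

/-- `C_T`: the code shortened on `T`, that is, the subcode `C(T)` punctured on `T`. -/
def shortened (C : Submodule F (ι → F)) (T : Finset ι) :
    Submodule F ({i : ι // i ∉ T} → F) :=
  punctured (zeroOn C T) T

/-- `A_w(C)`: the number of codewords of Hamming weight `w`. -/
noncomputable def weightCount [Fintype ι] [DecidableEq F] (C : Submodule F (ι → F)) (w : ℕ) : ℕ :=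
  Set.ncard {c : ι → F | c ∈ C ∧ hammingNorm c = w}

/-- The set of Hamming weights of the nonzero codewords. -/
def nonzeroWeights [Fintype ι] [DecidableEq F] (C : Submodule F (ι → F)) : Set ℕ :=
  {w | ∃ c ∈ C, c ≠ 0 ∧ hammingNorm c = w}

/-- A two-weight code: its nonzero codewords have exactly two distinct Hamming weights. -/
def IsTwoWeight [Fintype ι] [DecidableEq F] (C : Submodule F (ι → F)) : Prop :=
  (nonzeroWeights C).ncard = 2

end Codes

section Bent

variable {K : Type*} [Field K] [Algebra (ZMod 2) K]

/-- The Walsh transform `∑ₓ (-1) ^ (f(x) + Tr(μ x))` of a Boolean function on a finite field of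
characteristic two, `Tr` being the absolute trace. -/
noncomputable def walsh [Fintype K] (f : K → ZMod 2) (μ : K) : ℤ :=
  ∑ x : K, (-1 : ℤ) ^ (f x + Algebra.trace (ZMod 2) K (μ * x)).val

/-- A Boolean function on `GF(2^n)` is bent if all its Walsh coefficients are `± 2 ^ (n / 2)`,
which is `± √(2 ^ n)`, `2 ^ n` being the number of elements of the field. -/
def IsBent [Fintype K] (f : K → ZMod 2) : Prop :=
  ∀ μ : K, (walsh f μ : ℝ) = √(Fintype.card K : ℝ) ∨ (walsh f μ : ℝ) = -√(Fintype.card K : ℝ)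

/-- The support `D_f` of a Boolean function. -/
def boolSupport {K : Type*} [Fintype K] (f : K → ZMod 2) : Finset K :=
  Finset.univ.filter fun x => f x ≠ 0

/-- The binary code of all words `(Tr(x dᵢ) + y)ᵢ` with `x ∈ K` and `y ∈ GF(2)`. -/
def traceCode {ι : Type*} (d : ι → K) : Submodule (ZMod 2) (ι → ZMod 2) where
  carrier := {c | ∃ (x : K) (y : ZMod 2), c = fun i => Algebra.trace (ZMod 2) K (x * d i) + y}
  zero_mem' := ⟨0, 0, by ext i; simp⟩
  add_mem' := by
    rintro _ _ ⟨x, y, rfl⟩ ⟨x', y', rfl⟩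
    refine ⟨x + x', y + y', ?_⟩
    ext i
    simp only [Pi.add_apply, add_mul, map_add]
    ring
  smul_mem' := by
    rintro r _ ⟨x, y, rfl⟩
    refine ⟨r • x, r * y, ?_⟩
    ext i
    simp only [Pi.smul_apply, smul_eq_mul, smul_mul_assoc, map_smul]
    ring

end Bent

end BentCode

open BentCode

/-! Let `e` be the support element at the shortened coordinate. The shortened code consists of the
words with entries Tr(x(u - e)), u in the support, and the sign sum S(x) of such a word is ν -
2·weight. For x ≠ 0 the full character sum vanishes, so 2S(x) is the Walsh value at x up to sign.
Bentness gives S(x) = ±2^((n-2)/2), hence two weights. The frequencies solve two linear equations: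
there are 2^n - 1 nonzero x, and S sums to 2^n over all x (`sum_supportSum`). The Walsh value at 0
gives ν(2^n - ν) = 2^(n-2)(2^n - 1), which puts the solution in the stated form. -/

namespace BentCode

/-- The nontrivial additive character of `GF(2)`, with integer values. -/
def binarySign (z : ZMod 2) : ℤ := (-1) ^ z.val

lemma binarySign_add : ∀ a b : ZMod 2, binarySign (a + b) = binarySign a * binarySign b := by
  decide

lemma binarySign_sub : ∀ a b : ZMod 2, binarySign (a - b) = binarySign a * binarySign b := by
  decide

lemma binarySign_eq_or : ∀ a : ZMod 2, binarySign a = 1 ∨ binarySign a = -1 := by decide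

lemma binarySign_eq : ∀ a : ZMod 2, binarySign a = 1 - 2 * (if a ≠ 0 then 1 else 0) := by decide

lemma binarySign_of_ne_zero : ∀ a : ZMod 2, a ≠ 0 → binarySign a = -1 := by decide

lemma sum_binarySign {ι : Type*} [Fintype ι] (c : ι → ZMod 2) :
    ∑ i, binarySign (c i) = (Fintype.card ι : ℤ) - 2 * hammingNorm c := by
  simp only [binarySign_eq, Finset.sum_sub_distrib, ← Finset.mul_sum, Finset.sum_boole,
    hammingNorm]
  simp

/-! ### The shortened code as a linear image -/

section Bent

variable {K : Type*} [Field K] [Algebra (ZMod 2) K]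

/-- The codeword `(Tr(x (dᵢ - dₜ)))ᵢ`, as a linear function of `x`. -/
noncomputable def shortenedWord {ι : Type*} (d : ι → K) (t : ι) (T : Finset ι) :
    K →ₗ[ZMod 2] ({i : ι // i ∉ T} → ZMod 2) :=
  LinearMap.pi fun i =>
    (Algebra.trace (ZMod 2) K).comp (LinearMap.mulRight (ZMod 2) (d i - d t))

lemma shortenedWord_apply {ι : Type*} (d : ι → K) (t : ι) (T : Finset ι) (x : K)
    (i : {i : ι // i ∉ T}) :
    shortenedWord d t T x i = Algebra.trace (ZMod 2) K (x * (d i - d t)) := rfl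

/-- Vanishing at `t` forces the constant y to be -Tr(x dₜ). -/
lemma shortened_traceCode {ι : Type*} (d : ι → K) (t : ι) :
    shortened (traceCode d) {t} = LinearMap.range (shortenedWord d t {t}) := by
  ext c
  constructor
  · rintro ⟨c', ⟨⟨x, y, rfl⟩, h0⟩, rfl⟩
    refine ⟨x, ?_⟩
    have h := h0 t (Finset.mem_singleton_self t)
    ext i
    simp only [shortenedWord_apply, LinearMap.funLeft_apply, mul_sub, map_sub]
    rw [eq_neg_of_add_eq_zero_left h]
    ring
  · rintro ⟨x, rfl⟩
    refine ⟨fun i => Algebra.trace (ZMod 2) K (x * d i) + -Algebra.trace (ZMod 2) K (x * d t),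
      ⟨⟨x, _, rfl⟩, ?_⟩, ?_⟩
    · intro i hi
      rw [Finset.mem_singleton.mp hi]
      exact add_neg_cancel _
    · ext i
      simp only [shortenedWord_apply, LinearMap.funLeft_apply, mul_sub, map_sub]
      ring

/-! ### Character sums over the support -/

variable [Fintype K]

lemma sum_binarySign_trace_mul {a : K} (ha : a ≠ 0) :
    ∑ x : K, binarySign (Algebra.trace (ZMod 2) K (a * x)) = 0 := by
  obtain ⟨b, hb⟩ : ∃ b, Algebra.trace (ZMod 2) K (a * b) ≠ 0 := by
    by_contra! h
    exact ha ((traceForm_nondegenerate (ZMod 2) K).1 a h)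
  -- Translation by `b` permutes the field but negates the sum.
  have h := Equiv.sum_comp (Equiv.addRight b)
    (fun x : K => binarySign (Algebra.trace (ZMod 2) K (a * x)))
  simp only [Equiv.coe_addRight, mul_add, map_add, binarySign_add,
    binarySign_of_ne_zero _ hb, ← Finset.sum_mul] at h
  linarith

lemma walsh_eq (f : K → ZMod 2) (μ : K) :
    walsh f μ = ∑ x : K, binarySign (Algebra.trace (ZMod 2) K (μ * x)) -
      2 * ∑ u ∈ boolSupport f, binarySign (Algebra.trace (ZMod 2) K (μ * u)) := by
  have h : ∀ x, (-1 : ℤ) ^ (f x + Algebra.trace (ZMod 2) K (μ * x)).val =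
      binarySign (Algebra.trace (ZMod 2) K (μ * x)) -
        2 * (if f x ≠ 0 then binarySign (Algebra.trace (ZMod 2) K (μ * x)) else 0) := by
    intro x
    change binarySign _ = _
    rw [binarySign_add, binarySign_eq (f x)]
    split_ifs <;> ring
  simp only [walsh, h, Finset.sum_sub_distrib, ← Finset.mul_sum, boolSupport, Finset.sum_filter]

/-- The signed sum of the trace function over the support of `f`, translated by `e`. -/
noncomputable def supportSum (f : K → ZMod 2) (e x : K) : ℤ :=
  ∑ u ∈ boolSupport f, binarySign (Algebra.trace (ZMod 2) K (x * (u - e)))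

lemma supportSum_zero (f : K → ZMod 2) (e : K) : supportSum f e 0 = (boolSupport f).card := by
  simp [supportSum, binarySign]

lemma two_mul_supportSum (f : K → ZMod 2) (e : K) {x : K} (hx : x ≠ 0) :
    2 * supportSum f e x = - walsh f x * binarySign (Algebra.trace (ZMod 2) K (x * e)) := by
  rw [walsh_eq, sum_binarySign_trace_mul hx]
  simp only [supportSum, mul_sub, map_sub, binarySign_sub, ← Finset.sum_mul]
  ring

/-- After exchanging the sums, orthogonality of characters kills every term except u = e. -/
lemma sum_supportSum (f : K → ZMod 2) {e : K} (he : e ∈ boolSupport f) :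
    ∑ x, supportSum f e x = Fintype.card K := by
  simp only [supportSum]
  rw [Finset.sum_comm, Finset.sum_eq_single_of_mem e he]
  · simp [binarySign]
  · intro u _ hu
    simpa only [mul_comm] using sum_binarySign_trace_mul (sub_ne_zero.mpr hu)

lemma walsh_zero (f : K → ZMod 2) :
    walsh f 0 = (Fintype.card K : ℤ) - 2 * (boolSupport f).card := by
  rw [walsh_eq]
  simp [binarySign]

lemma IsBent.walsh_eq_or {f : K → ZMod 2} (hf : IsBent f) {s : ℕ}
    (hs : Fintype.card K = s ^ 2) (μ : K) : walsh f μ = s ∨ walsh f μ = -s := by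
  have h := hf μ
  rw [hs, Nat.cast_pow, Real.sqrt_sq (Nat.cast_nonneg s)] at h
  exact_mod_cast h

lemma IsBent.supportSum_eq_or {f : K → ZMod 2} (hf : IsBent f) {s : ℕ}
    (hs : Fintype.card K = (2 * s) ^ 2) (e : K) {x : K} (hx : x ≠ 0) :
    supportSum f e x = s ∨ supportSum f e x = -s := by
  have h := two_mul_supportSum f e hx
  have h1 := hf.walsh_eq_or hs x
  have h2 := binarySign_eq_or (Algebra.trace (ZMod 2) K (x * e))
  push_cast at h1
  rcases h1 with h1 | h1 <;> rcases h2 with h2 | h2 <;> rw [h1, h2] at h <;> omega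

/-- The sum runs over all coordinates, including `t`; the entry there is 0, so deleting it leaves
the weight unchanged. -/
lemma supportSum_eq_hammingNorm (f : K → ZMod 2) {ι : Type*} [Fintype ι] [DecidableEq ι]
    (d : ι ≃ {x : K // x ∈ boolSupport f}) (t : ι) (x : K) :
    supportSum f (d t : K) x = (boolSupport f).card -
      2 * hammingNorm (shortenedWord (fun i => (d i : K)) t {t} x) := by
  have h1 : supportSum f (d t : K) x =
      ∑ i, binarySign (Algebra.trace (ZMod 2) K (x * ((d i : K) - d t))) := by
    rw [supportSum, ← Finset.sum_coe_sort]
    exact (Equiv.sum_comp d fun u : {x : K // x ∈ boolSupport f} =>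
      binarySign (Algebra.trace (ZMod 2) K (x * ((u : K) - d t)))).symm
  have h2 : Fintype.card ι = (boolSupport f).card := by
    rw [Fintype.card_congr d, Fintype.card_coe]
  rw [h1, sum_binarySign, h2]
  congr 3
  symm
  unfold hammingNorm
  refine Finset.card_bij (fun i _ => (i : ι)) ?_ ?_ ?_
  · intro i hi
    exact Finset.mem_filter.mpr ⟨Finset.mem_univ _, (Finset.mem_filter.mp hi).2⟩
  · intro i _ j _ h
    exact Subtype.ext h
  · intro i hi
    have hit : i ∉ ({t} : Finset ι) := by
      rintro h
      rw [Finset.mem_singleton.mp h] at hi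
      simp at hi
    exact ⟨⟨i, hit⟩, Finset.mem_filter.mpr ⟨Finset.mem_univ _, (Finset.mem_filter.mp hi).2⟩, rfl⟩

/-! ### Counting codewords by weight -/

lemma weightCount_range {F ι V : Type*} [Field F] [DecidableEq F] [Fintype ι] [AddCommGroup V]
    [Module F V] [Fintype V] {g : V →ₗ[F] (ι → F)} (hg : Function.Injective g) (w : ℕ) :
    weightCount (LinearMap.range g) w =
      (Finset.univ.filter fun x => hammingNorm (g x) = w).card := by
  have h : {c : ι → F | c ∈ LinearMap.range g ∧ hammingNorm c = w} =
      g '' {x | hammingNorm (g x) = w} := by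
    ext c
    constructor
    · rintro ⟨⟨x, rfl⟩, h⟩
      exact ⟨x, h, rfl⟩
    · rintro ⟨x, h, rfl⟩
      exact ⟨⟨x, rfl⟩, h⟩
  rw [weightCount, h, Set.ncard_image_of_injective _ hg, ← Set.ncard_coe_finset]
  simp

end Bent

/-- The numbers of elements with each of the two weights, from the first power moment. -/
lemma card_filter_of_two_values {V : Type*} [Fintype V] [DecidableEq V] (o : V) (S : V → ℤ)
    (w : V → ℕ) {ν s : ℤ} {w₁ w₂ : ℕ} (hs : 0 < s) (hw : ∀ x, S x = ν - 2 * w x)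
    (h₁ : (2 * w₁ : ℤ) = ν - s) (h₂ : (2 * w₂ : ℤ) = ν + s) (ho : w o = 0) (hw₁ : 0 < w₁)
    (hS : ∀ x, x ≠ o → S x = s ∨ S x = -s) :
    ((Finset.univ.filter fun x => w x = w₁).card : ℤ) +
        (Finset.univ.filter fun x => w x = w₂).card = Fintype.card V - 1 ∧
      s * (((Finset.univ.filter fun x => w x = w₁).card : ℤ) -
        (Finset.univ.filter fun x => w x = w₂).card) = ∑ x, S x - ν := by
  -- Pointwise forms of both equations; `o` has weight 0 and S-value ν, hence the corrections.
  have key : ∀ x, (if w x = w₁ then (1 : ℤ) else 0) + (if w x = w₂ then 1 else 0) =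
      1 - (if x = o then 1 else 0) ∧
      s * ((if w x = w₁ then (1 : ℤ) else 0) - (if w x = w₂ then 1 else 0)) =
      S x - (if x = o then ν else 0) := by
    intro x
    by_cases hx : x = o
    · subst hx
      have := hw x
      rw [ho] at this
      rw [if_neg (by omega), if_neg (by omega), if_pos rfl, if_pos rfl]
      constructor <;> simp [this]
    · have := hw x
      rw [if_neg hx, if_neg hx]
      rcases hS x hx with h | h
      · rw [if_pos (by omega), if_neg (by omega), h]
        constructor <;> ring
      · rw [if_neg (by omega), if_pos (by omega), h]
        constructor <;> ring
  have e : ∀ v : ℕ, ((Finset.univ.filter fun x => w x = v).card : ℤ) =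
      ∑ x, if w x = v then 1 else 0 := by
    intro v
    simp
  rw [e, e]
  constructor
  · rw [← Finset.sum_add_distrib, Finset.sum_congr rfl fun x _ => (key x).1]
    simp
  · rw [← Finset.sum_sub_distrib, Finset.mul_sum, Finset.sum_congr rfl fun x _ => (key x).2]
    simp

end BentCode

/-! ### The weight distribution -/

open BentCode
theorem mainTheorem9 {K : Type*} [Field K] [Fintype K] [Algebra (ZMod 2) K]
    (n : ℕ) (hn : 6 ≤ n) (hn_even : Even n) (hK : Fintype.card K = 2 ^ n)
    (f : K → ZMod 2) (hf : IsBent f)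
    (ν : ℕ) (hν : ν = (boolSupport f).card)
    (d : Fin ν ≃ {x : K // x ∈ boolSupport f}) (t₁ : Fin ν)
    (C : Submodule (ZMod 2) ({i : Fin ν // i ∉ ({t₁} : Finset (Fin ν))} → ZMod 2))
    (hC : C = shortened (traceCode fun i => (d i : K)) {t₁}) :
    BentCode.length C = ν - 1 ∧ dimension C = n ∧ IsTwoWeight C ∧
    ∃ w₁ w₂ : ℕ,
      (w₁ : ℚ) = (ν : ℚ) / 2 - 2 ^ ((n - 4) / 2) ∧
      (w₂ : ℚ) = (ν : ℚ) / 2 + 2 ^ ((n - 4) / 2) ∧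
      0 < w₁ ∧ w₁ < w₂ ∧
      weightCount C 0 = 1 ∧
      (weightCount C w₁ : ℚ) =
        ((ν : ℚ) + 2 ^ ((n - 2) / 2)) / (2 * (ν : ℚ)) * (2 ^ n - 1) ∧
      (weightCount C w₂ : ℚ) =
        ((ν : ℚ) - 2 ^ ((n - 2) / 2)) / (2 * (ν : ℚ)) * (2 ^ n - 1) ∧
      ∀ w : ℕ, w ≠ 0 → w ≠ w₁ → w ≠ w₂ → weightCount C w = 0 := by
  classical
  -- All powers of 2 are expressed through a = 2^((n-4)/2), so |S(x)| = 2a for x ≠ 0.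
  obtain ⟨a, ha, hn4, hn2, hna⟩ : ∃ a : ℕ, 2 ≤ a ∧ 2 ^ ((n - 4) / 2) = a ∧
      2 ^ ((n - 2) / 2) = 2 * a ∧ 2 ^ n = 16 * a ^ 2 := by
    obtain ⟨k, rfl⟩ : ∃ k, n = 2 * (k + 3) := by
      obtain ⟨m, rfl⟩ := hn_even
      exact ⟨m - 3, by omega⟩
    refine ⟨2 ^ (k + 1), ?_, ?_, ?_, by ring⟩
    · rw [pow_succ]
      have := Nat.one_le_two_pow (n := k)
      omega
    · congr 1
      omega
    · rw [show (2 * (k + 3) - 2) / 2 = k + 1 + 1 by omega, pow_succ, mul_comm]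
  have hcard : Fintype.card K = (2 * (2 * a)) ^ 2 := by rw [hK, hna]; ring
  set g := shortenedWord (fun i => (d i : K)) t₁ {t₁}
  set S := supportSum f (d t₁ : K) with hSdef
  have hSw : ∀ x, S x = ν - 2 * hammingNorm (g x) := by
    intro x
    subst hν
    exact supportSum_eq_hammingNorm f d t₁ x
  have hS : ∀ x, x ≠ 0 → S x = (2 * a : ℕ) ∨ S x = -(2 * a : ℕ) :=
    fun x hx => hf.supportSum_eq_or hcard _ hx
  have hsum : ∑ x, S x = 16 * a ^ 2 := by
    rw [hSdef, sum_supportSum f (d t₁).2, hK, hna]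
    push_cast
    ring
  have hνa : (ν : ℤ) = 8 * a ^ 2 - 2 * a ∨ (ν : ℤ) = 8 * a ^ 2 + 2 * a := by
    have h := hf.walsh_eq_or hcard 0
    rw [walsh_zero, ← hν, hcard] at h
    push_cast at h
    rcases h with h | h
    · left; linarith
    · right; linarith
  have haa : 2 * (a : ℤ) ≤ a ^ 2 := by
    have : (2 : ℤ) ≤ a := by exact_mod_cast ha
    nlinarith
  obtain ⟨b, hb⟩ : ∃ b : ℕ, ν = 2 * b := by
    refine ⟨ν / 2, ?_⟩
    rcases hνa with h | h <;> omega
  have hba : a < b := by rcases hνa with h | h <;> omega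
  -- Symmetric under ν ↦ 2^n - ν, so the sign of the Walsh value at 0 drops out.
  have hprod : (ν : ℤ) * (16 * a ^ 2 - ν) = 4 * a ^ 2 * (16 * a ^ 2 - 1) := by
    rcases hνa with h | h <;> rw [h] <;> ring
  have hinj : Function.Injective g := by
    rw [injective_iff_map_eq_zero]
    intro x hx
    by_contra hx0
    -- A zero word would give S(x) = ν, but ν > 2a.
    have h := hSw x
    rw [hx, hammingNorm_zero] at h
    have := hS x hx0
    omega
  have hwt : ∀ x, x ≠ 0 → hammingNorm (g x) = b - a ∨ hammingNorm (g x) = b + a := by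
    intro x hx
    have h := hSw x
    have := hS x hx
    omega
  have hCg : C = LinearMap.range g := hC.trans (shortened_traceCode _ _)
  have hcount : ∀ w, weightCount C w = (Finset.univ.filter fun x => hammingNorm (g x) = w).card :=
    fun w => by rw [hCg]; exact weightCount_range hinj w
  obtain ⟨hadd, hsub⟩ := card_filter_of_two_values (0 : K) S (fun x => hammingNorm (g x))
    (ν := ν) (s := (2 * a : ℕ)) (w₁ := b - a) (w₂ := b + a) (by omega) hSw (by omega) (by omega)
    (by simp) (by omega) hS
  rw [← hcount, ← hcount, hK, hna] at hadd
  rw [← hcount, ← hcount, hsum] at hsub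
  have hν0 : (0 : ℚ) < ν := by exact_mod_cast (by omega : 0 < ν)
  have haq : (0 : ℚ) < a := by exact_mod_cast (by omega : 0 < a)
  have hbaq : (a : ℚ) < b := by exact_mod_cast hba
  have hνq : (ν : ℚ) = 2 * b := by exact_mod_cast hb
  have hnaq : (2 : ℚ) ^ n = 16 * a ^ 2 := by exact_mod_cast hna
  have hn2q : (2 : ℚ) ^ ((n - 2) / 2) = 2 * a := by exact_mod_cast hn2
  have hn4q : (2 : ℚ) ^ ((n - 4) / 2) = a := by exact_mod_cast hn4
  have hadd' : (weightCount C (b - a) : ℚ) + weightCount C (b + a) = 16 * a ^ 2 - 1 := by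
    exact_mod_cast hadd
  have hsub' : 2 * (a : ℚ) * (weightCount C (b - a) - weightCount C (b + a)) =
      16 * a ^ 2 - ν := by
    exact_mod_cast hsub
  have hprod' : (ν : ℚ) * (16 * a ^ 2 - ν) = 4 * a ^ 2 * (16 * a ^ 2 - 1) := by
    exact_mod_cast hprod
  have hdiff : (ν : ℚ) * (weightCount C (b - a) - weightCount C (b + a)) =
      2 * a * (16 * a ^ 2 - 1) := by
    have h2a : (2 * a : ℚ) ≠ 0 := by positivity
    apply mul_left_cancel₀ h2a
    linear_combination (ν : ℚ) * hsub' + hprod'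
  have hc₁ : (weightCount C (b - a) : ℚ) =
      ((ν : ℚ) + 2 ^ ((n - 2) / 2)) / (2 * (ν : ℚ)) * (2 ^ n - 1) := by
    rw [hn2q, hnaq]
    field_simp
    linear_combination (ν : ℚ) * hadd' + hdiff
  have hc₂ : (weightCount C (b + a) : ℚ) =
      ((ν : ℚ) - 2 ^ ((n - 2) / 2)) / (2 * (ν : ℚ)) * (2 ^ n - 1) := by
    rw [hn2q, hnaq]
    field_simp
    linear_combination (ν : ℚ) * hadd' - hdiff
  have ha2 : (0 : ℚ) < 16 * a ^ 2 - 1 := by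
    have : (2 : ℚ) ≤ a := by exact_mod_cast ha
    nlinarith
  have hpos : ∀ w, (0 : ℚ) < weightCount C w → ∃ x, hammingNorm (g x) = w := by
    intro w hw
    rw [hcount, Nat.cast_pos, Finset.card_pos] at hw
    obtain ⟨x, hx⟩ := hw
    exact ⟨x, (Finset.mem_filter.mp hx).2⟩
  -- Both weights occur: their frequencies are positive because ν > 2a.
  obtain ⟨x₁, hx₁⟩ := hpos (b - a) (by
    rw [hc₁, hn2q, hnaq]
    positivity)
  obtain ⟨x₂, hx₂⟩ := hpos (b + a) (by
    rw [hc₂, hn2q, hnaq]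
    have : (0 : ℚ) < ν - 2 * a := by linarith
    positivity)
  refine ⟨?_, ?_, ?_, b - a, b + a, ?_, ?_, by omega, by omega, ?_, hc₁, hc₂, ?_⟩
  · simp [BentCode.length]
  · rw [dimension, hCg, LinearMap.finrank_range_of_inj hinj]
    have h := Module.card_eq_pow_finrank (K := ZMod 2) (V := K)
    rw [hK, ZMod.card] at h
    exact (Nat.pow_right_injective le_rfl h).symm
  · have hset : nonzeroWeights C = {b - a, b + a} := by
      ext w
      constructor
      · rintro ⟨c, hc, hc0, rfl⟩
        rw [hCg] at hc
        obtain ⟨x, rfl⟩ := hc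
        exact hwt x fun h => hc0 (by rw [h, map_zero])
      · have aux : ∀ x, 0 < hammingNorm (g x) → hammingNorm (g x) ∈ nonzeroWeights C :=
          fun x hx => ⟨g x, hCg ▸ ⟨x, rfl⟩, hammingNorm_pos_iff.mp hx, rfl⟩
        rintro (rfl | rfl)
        · exact hx₁ ▸ aux x₁ (by omega)
        · exact hx₂ ▸ aux x₂ (by omega)
    rw [IsTwoWeight, hset, Set.ncard_pair (by omega)]
  · rw [Nat.cast_sub hba.le, hνq, hn4q]
    ring
  · rw [Nat.cast_add, hνq, hn4q]
    ring
  · rw [hcount, Finset.card_eq_one]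
    refine ⟨0, ?_⟩
    ext x
    rw [Finset.mem_filter, Finset.mem_singleton, hammingNorm_eq_zero, map_eq_zero_iff g hinj]
    simp
  · intro w h0 h1 h2
    rw [hcount, Finset.card_eq_zero, Finset.filter_eq_empty_iff]
    intro x _ hx
    by_cases hx0 : x = 0
    · rw [hx0, map_zero, hammingNorm_zero] at hx
      exact h0 hx.symm
    · rcases hwt x hx0 with h | h <;> omega
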